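/- **Setting.** Let $X^{(1)},\dots,X^{(n)}$ be real random variables (low-fidelity outputs), $Y$ a random element and $f$ a measurable real function ($f(Y)$ is the high-fidelity output). Let $\emptyset\neq S\subseteq[n]$ be fixed, $s=|S|$, and $X_S=(1,(X^{(i)})_{i\in S})^T\in\mathbb R^{s+1}$. Assume the linear model $$f(Y)=X_S^T\beta_S+\varepsilon_S \quad\text{a.s.},$$ with $\beta_S\in\mathbb R^{s+1}$ and $\varepsilon_S$ independent of $X_S$, centered and sub-Gaussian. Assume that $\Lambda_S=\mathbb E[X_SX_S^T]$ is invertible and that for some finite $K\ge 1$ $$\max\Big\{\sup_{\|\theta\|_2=1}\mathbb E[\langle X_S,\theta\rangle^4]^{1/4},\ \big\|\|X_S\|_2\big\|_{\psi_1}\Big\}\le K .$$ Here $\|W\|_{\psi_\alpha}=\inf\{C>0:\mathbb E[\exp(|W|^\alpha/C^\alpha)]\le 2\}$, and sub-Gaussian means $\|\varepsilon_S\|_{\psi_2}<\infty$. **Estimator.** Let $c_0>0$ and $c_i>0$ be the costs of sampling $Y$ and the $i$-th low-fidelity model, $c_{\rm epr}=\sum_{i=0}^n c_i$ and $c_{\rm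 ept}(S)=\sum_{i\in S}c_i$. For $k\ge1$ let $B_k$ be a budget, $m_k$ a (deterministic) number of exploration rounds, and $N_k=\lfloor (B_k-c_{\rm epr}m_k)/c_{\rm ept}(S)\rfloor$ (read as $0$ if this is negative) the number of affordable exploitation samples. * *Exploration.* Let $(X^{(1)}_\ell,\dots,X^{(n)}_\ell,f(Y_\ell))_{\ell\ge1}$ be i.i.d. copies of $(X^{(1)},\dots,X^{(n)},f(Y))$. Under budget $B_k$ the first $m_k$ of them are used: $\widehat\beta_{S,k}=Z_{S,k}^\dagger\,(f(Y_1),\dots,f(Y_{m_k}))^T$, where $Z_{S,k}$ is the $m_k\times(s+1)$ matrix with rows $(1,(X^{(i)}_\ell)_{i\in S})$, $\ell\le m_k$, and $\dagger$ is the Moore–Penrose pseudoinverse. * *Exploitation.* For each $k$ let $(X_{S,k,\ell})_{\ell\ge1}$ be i.i.d. copies of $X_S$, independent of the exploration samples (with no assumption on the joint law over different $k$), and $$\mathsf{LRMC}_{S,k}=\frac1{N_k}\sum_{\ell=1}^{N_k}X_{S,k,\ell}^T\,\widehat\beta_{S,k}.$$ **Corollary (consistency of the LRMC).** If $B_k\to\infty$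 and $\min(m_k,N_k)\to\infty$, then for almost every sequence $(\widehat\beta_{S,k})_{k\ge1}$ of coefficient estimates, $\mathsf{LRMC}_{S,k}\to\mathbb E[f(Y)]$ in probability as $k\to\infty$. That is, for almost every $b=(b_k)_{k\ge1}$ with respect to the law of $(\widehat\beta_{S,k})_{k\ge1}$, the convergence holds in probability under the regular conditional law of $(\mathsf{LRMC}_{S,k})_{k\ge1}$ given $(\widehat\beta_{S,k})_{k\ge1}=b$. -/

import Mathlib

open MeasureTheory ProbabilityTheory Filter Topology
open scoped ENNReal Matrix

namespace LRMC

/-! ### The Moore-Penrose pseudoinverse of a real matrix -/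

section Pinv

variable {ι κ : Type*} [Fintype ι] [Fintype κ]

/-- The four Penrose equations: `P` is a Moore-Penrose pseudoinverse of `A`. -/
structure IsMoorePenrose (A : Matrix ι κ ℝ) (P : Matrix κ ι ℝ) : Prop where
  mul_mul_self : A * P * A = A
  self_mul_mul : P * A * P = P
  transpose_left : (A * P)ᵀ = A * P
  transpose_right : (P * A)ᵀ = P * A

theorem IsMoorePenrose.unique {A : Matrix ι κ ℝ} {P Q : Matrix κ ι ℝ}
    (hP : IsMoorePenrose A P) (hQ : IsMoorePenrose A Q) : P = Q := by
  have hl : A * P = A * Q := by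
    calc A * P = (A * P)ᵀ := hP.transpose_left.symm
      _ = ((A * Q) * (A * P))ᵀ := by
          rw [← Matrix.mul_assoc (A * Q) A P, hQ.mul_mul_self]
      _ = (A * P) * (A * Q) := by
          rw [Matrix.transpose_mul, hP.transpose_left, hQ.transpose_left]
      _ = A * Q := by rw [← Matrix.mul_assoc (A * P) A Q, hP.mul_mul_self]
  have hr : P * A = Q * A := by
    calc P * A = (P * A)ᵀ := hP.transpose_right.symm
      _ = ((P * A) * (Q * A))ᵀ := by
          rw [Matrix.mul_assoc P A (Q * A), ← Matrix.mul_assoc A Q A, hQ.mul_mul_self]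
      _ = (Q * A) * (P * A) := by
          rw [Matrix.transpose_mul, hP.transpose_right, hQ.transpose_right]
      _ = Q * A := by
          rw [Matrix.mul_assoc Q A (P * A), ← Matrix.mul_assoc A P A, hP.mul_mul_self]
  calc P = P * A * P := hP.self_mul_mul.symm
    _ = Q * A * P := by rw [hr]
    _ = Q * (A * P) := Matrix.mul_assoc _ _ _
    _ = Q * A * Q := by rw [hl, Matrix.mul_assoc]
    _ = Q := hQ.self_mul_mul

theorem exists_isMoorePenrose (A : Matrix ι κ ℝ) : ∃ P, IsMoorePenrose A P := by
  classical
  obtain ⟨G, hGt, hMGM, hGMG, hcomm⟩ : ∃ G : Matrix κ κ ℝ, Gᵀ = G ∧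
      (Aᵀ * A) * G * (Aᵀ * A) = Aᵀ * A ∧ G * (Aᵀ * A) * G = G ∧
      G * (Aᵀ * A) = (Aᵀ * A) * G := by
    have hM : (Aᵀ * A).IsHermitian := by
      simpa [Matrix.conjTranspose_eq_transpose_of_trivial]
        using Matrix.isHermitian_conjTranspose_mul_self A
    set U : Matrix κ κ ℝ := (hM.eigenvectorUnitary : Matrix κ κ ℝ) with hU
    have hUU : Uᵀ * U = 1 := by
      have := Unitary.coe_star_mul_self hM.eigenvectorUnitary
      simpa [Matrix.star_eq_conjTranspose, Matrix.conjTranspose_eq_transpose_of_trivial] using this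
    set d := hM.eigenvalues
    have hs : Aᵀ * A = U * Matrix.diagonal d * Uᵀ := by
      have := hM.spectral_theorem
      simpa [Unitary.conjStarAlgAut_apply, Matrix.star_eq_conjTranspose,
        Matrix.conjTranspose_eq_transpose_of_trivial, Function.comp_def] using this
    have key : ∀ a b : κ → ℝ, (U * Matrix.diagonal a * Uᵀ) * (U * Matrix.diagonal b * Uᵀ)
        = U * Matrix.diagonal (fun i => a i * b i) * Uᵀ := by
      intro a b
      calc _ = U * Matrix.diagonal a * (Uᵀ * U) * Matrix.diagonal b * Uᵀ := by
            simp only [Matrix.mul_assoc]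
        _ = _ := by
            rw [hUU, Matrix.mul_one, Matrix.mul_assoc U, Matrix.diagonal_mul_diagonal]
    refine ⟨U * Matrix.diagonal (fun i => (d i)⁻¹) * Uᵀ, ?_, ?_, ?_, ?_⟩
    · simp [Matrix.transpose_mul, Matrix.mul_assoc]
    · rw [hs, key, key]; congr; ext i; simp
    · rw [hs, key, key]; congr; ext i; by_cases h : d i = 0 <;> simp [h]
    · rw [hs, key, key]; congr; ext i; ring
  have hAG : A * (G * (Aᵀ * A)) = A := by
    have h0 : (Aᵀ * A) * (G * (Aᵀ * A) - 1) = 0 := by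
      rw [Matrix.mul_sub, Matrix.mul_one, ← Matrix.mul_assoc, hMGM, sub_self]
    have h1 := (Matrix.conjTranspose_mul_self_mul_eq_zero A (G * (Aᵀ * A) - 1)).1
      (by simpa [Matrix.conjTranspose_eq_transpose_of_trivial] using h0)
    rw [Matrix.mul_sub, Matrix.mul_one, sub_eq_zero] at h1
    exact h1
  refine ⟨G * Aᵀ, ?_, ?_, ?_, ?_⟩
  · rw [Matrix.mul_assoc, Matrix.mul_assoc, hAG]
  · calc G * Aᵀ * A * (G * Aᵀ) = (G * (Aᵀ * A) * G) * Aᵀ := by simp only [Matrix.mul_assoc]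
      _ = G * Aᵀ := by rw [hGMG]
  · simp [Matrix.transpose_mul, hGt, Matrix.mul_assoc]
  · calc (G * Aᵀ * A)ᵀ = (Aᵀ * A) * G := by simp [Matrix.transpose_mul, hGt, Matrix.mul_assoc]
      _ = G * Aᵀ * A := by rw [← hcomm, Matrix.mul_assoc]

/-- The Moore-Penrose pseudoinverse. -/
noncomputable def pinv (A : Matrix ι κ ℝ) : Matrix κ ι ℝ :=
  Classical.choose (exists_isMoorePenrose A)

theorem isMoorePenrose_pinv (A : Matrix ι κ ℝ) : IsMoorePenrose A (pinv A) :=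
  Classical.choose_spec (exists_isMoorePenrose A)

/-- For a matrix of full column rank the pseudoinverse is `(AᵀA)⁻¹Aᵀ`. -/
theorem pinv_eq_of_isUnit [DecidableEq κ] (A : Matrix ι κ ℝ) (h : IsUnit (Aᵀ * A)) :
    pinv A = (Aᵀ * A)⁻¹ * Aᵀ := by
  have hdet : IsUnit (Aᵀ * A).det := (Matrix.isUnit_iff_isUnit_det _).1 h
  have h1 : (Aᵀ * A)⁻¹ * Aᵀ * A = 1 := by
    rw [Matrix.mul_assoc]; exact Matrix.nonsing_inv_mul _ hdet
  have hsymm : ((Aᵀ * A)⁻¹)ᵀ = (Aᵀ * A)⁻¹ := by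
    rw [Matrix.transpose_nonsing_inv]; simp [Matrix.transpose_mul]
  refine (isMoorePenrose_pinv A).unique ⟨?_, ?_, ?_, ?_⟩
  · rw [Matrix.mul_assoc, h1, Matrix.mul_one]
  · rw [h1, Matrix.one_mul]
  · rw [Matrix.transpose_mul, Matrix.transpose_mul, hsymm, Matrix.transpose_transpose,
      Matrix.mul_assoc]
  · rw [h1, Matrix.transpose_one]

/-- The entries of the pseudoinverse are measurable functions of the matrix. -/
theorem measurable_pinv :
    Measurable (fun (A : ι → κ → ℝ) (j : κ) (i : ι) => pinv (Matrix.of A) j i) := by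
  let E := (ι → κ → ℝ) × (κ → ι → ℝ)
  let G : Set E := {p | IsMoorePenrose (Matrix.of p.1) (Matrix.of p.2)}
  have hG : IsClosed G := by
    have hA : Continuous fun p : E => (Matrix.of p.1 : Matrix ι κ ℝ) := continuous_fst
    have hP : Continuous fun p : E => (Matrix.of p.2 : Matrix κ ι ℝ) := continuous_snd
    have : G = {p : E | Matrix.of p.1 * Matrix.of p.2 * Matrix.of p.1 = Matrix.of p.1} ∩
        {p | Matrix.of p.2 * Matrix.of p.1 * Matrix.of p.2 = Matrix.of p.2} ∩
        {p | (Matrix.of p.1 * Matrix.of p.2)ᵀ = Matrix.of p.1 * Matrix.of p.2} ∩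
        {p | (Matrix.of p.2 * Matrix.of p.1)ᵀ = Matrix.of p.2 * Matrix.of p.1} := by
      ext p
      exact ⟨fun h => ⟨⟨⟨h.1, h.2⟩, h.3⟩, h.4⟩, fun h => ⟨h.1.1.1, h.1.1.2, h.1.2, h.2⟩⟩
    rw [this]
    have hAP := hA.matrix_mul hP
    have hPA := hP.matrix_mul hA
    exact (((isClosed_eq (hAP.matrix_mul hA) hA).inter
      (isClosed_eq (hPA.matrix_mul hP) hP)).inter
      (isClosed_eq hAP.matrix_transpose hAP)).inter (isClosed_eq hPA.matrix_transpose hPA)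
  have : PolishSpace G := hG.polishSpace
  let g : G → (ι → κ → ℝ) := fun p => p.1.1
  have hg : Continuous g := continuous_fst.comp continuous_subtype_val
  have hinj : Function.Injective g := by
    rintro ⟨⟨A, P⟩, hp⟩ ⟨⟨B, Q⟩, hq⟩ h
    have h' : A = B := h
    subst h'
    have : Matrix.of P = Matrix.of Q := IsMoorePenrose.unique hp hq
    have h2 : P = Q := this
    subst h2
    rfl
  have hemb := hg.measurableEmbedding hinj
  let F : (ι → κ → ℝ) → G := fun A =>
    ⟨(A, fun j i => pinv (Matrix.of A) j i), isMoorePenrose_pinv (Matrix.of A)⟩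
  have hF : Measurable F := by
    have hc : g ∘ F = id := rfl
    exact hemb.measurable_comp_iff.1 (hc ▸ measurable_id)
  exact measurable_snd.comp (measurable_subtype_coe.comp hF)

end Pinv

/-! ### Orlicz norms and the regressor vector -/

section Moments

variable {Ω : Type*} [MeasurableSpace Ω]

/-- The `α`-Orlicz norm `inf {C > 0 : 𝔼[exp (|W|^α / C^α)] ≤ 2}`; it is `∞` if no such `C`
exists. -/
noncomputable def orliczNorm (α : ℝ) (W : Ω → ℝ) (μ : Measure Ω) : ℝ≥0∞ :=
  ⨅ (C : ℝ) (_ : 0 < C ∧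
    ∫⁻ ω, ENNReal.ofReal (Real.exp (|W ω| ^ α / C ^ α)) ∂μ ≤ 2), ENNReal.ofReal C

/-- `sup_{‖θ‖₂ = 1} 𝔼[⟨V, θ⟩ ^ 4] ^ (1/4)` for a random vector `V`. -/
noncomputable def fourthMomentSup {κ : Type*} [Fintype κ] (V : Ω → κ → ℝ) (μ : Measure Ω) :
    ℝ≥0∞ :=
  ⨆ (θ : EuclideanSpace ℝ κ) (_ : ‖θ‖ = 1),
    (∫⁻ ω, ENNReal.ofReal ((inner ℝ (WithLp.toLp 2 (V ω)) θ) ^ 4) ∂μ) ^ (1 / 4 : ℝ)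

/-- The matrix `𝔼[V Vᵀ]`. -/
noncomputable def secondMoment {κ : Type*} (V : Ω → κ → ℝ) (μ : Measure Ω) : Matrix κ κ ℝ :=
  Matrix.of fun i j => ∫ ω, V ω i * V ω j ∂μ

end Moments

/-- The regressor vector `(1, (x i)_{i ∈ S})` of the model `S`; the index `none` is the
intercept. -/
def regressor {n : ℕ} (S : Finset (Fin n)) (x : Fin n → ℝ) : Option S → ℝ
  | none => 1
  | some i => x i

/-! ### Exploration -/

/-- Design matrix whose rows are the regressor vectors of the first `m` exploration samples. An
exploration sample is a pair consisting of the `n` low-fidelity outputs and the high-fidelity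
output. -/
def designMatrix {n : ℕ} (S : Finset (Fin n)) (m : ℕ) (D : ℕ → (Fin n → ℝ) × ℝ) :
    Matrix (Fin m) (Option S) ℝ :=
  Matrix.of fun l j => regressor S (D l).1 j

/-- The high-fidelity outputs of the first `m` exploration samples. -/
def responseVector {n : ℕ} (m : ℕ) (D : ℕ → (Fin n → ℝ) × ℝ) : Fin m → ℝ :=
  fun l => (D l).2

/-- The least squares coefficient estimate in the model `S` from the first `m` exploration
samples. -/
noncomputable def betaHat {n : ℕ} (S : Finset (Fin n)) (m : ℕ) (D : ℕ → (Fin n → ℝ) × ℝ) :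
    Option S → ℝ :=
  pinv (designMatrix S m D) *ᵥ responseVector m D

theorem measurable_betaHat {n : ℕ} (S : Finset (Fin n)) (m : ℕ) :
    Measurable (betaHat S m) := by
  have hdesign : Measurable fun (D : ℕ → (Fin n → ℝ) × ℝ) (l : Fin m) (j : Option S) =>
      regressor S (D l).1 j := by
    refine measurable_pi_lambda _ fun l => measurable_pi_lambda _ fun j => ?_
    cases j with
    | none => exact measurable_const
    | some i => exact (measurable_pi_apply _).comp (measurable_fst.comp (measurable_pi_apply _))
  have h := measurable_pinv.comp hdesign
  refine measurable_pi_lambda _ fun j => ?_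
  have h1 : ∀ l : Fin m, Measurable fun D : ℕ → (Fin n → ℝ) × ℝ => pinv (designMatrix S m D) j l :=
    fun l => (measurable_pi_apply l).comp ((measurable_pi_apply j).comp h)
  have h2 : ∀ l : Fin m, Measurable fun D : ℕ → (Fin n → ℝ) × ℝ => (D l).2 :=
    fun l => measurable_snd.comp (measurable_pi_apply (l : ℕ))
  have h3 : (fun D : ℕ → (Fin n → ℝ) × ℝ => betaHat S m D j) =
      fun D => ∑ l : Fin m, pinv (designMatrix S m D) j l * (D l).2 := rfl
  rw [h3]
  exact Finset.measurable_sum _ fun l _ => (h1 l).mul (h2 l)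

/-! ### Budget and exploitation -/

/-- Cost of one exploration round: one sample of the high-fidelity model and of every
low-fidelity model. -/
def costExplore {n : ℕ} (c₀ : ℝ) (c : Fin n → ℝ) : ℝ := c₀ + ∑ i, c i

/-- Cost of one exploitation sample of the model `S`. -/
def costExploit {n : ℕ} (c : Fin n → ℝ) (S : Finset (Fin n)) : ℝ := ∑ i ∈ S, c i

/-- Number of exploitation samples of the model `S` that are affordable with total budget `B`
after `m` exploration rounds. -/
noncomputable def numExploit {n : ℕ} (c₀ : ℝ) (c : Fin n → ℝ) (S : Finset (Fin n))
    (B : ℝ) (m : ℕ) : ℕ :=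
  ⌊(B - costExplore c₀ c * m) / costExploit c S⌋₊

/-- The linear regression Monte Carlo estimator `(1/N) ∑_{l < N} (W l)ᵀ b` with coefficient
vector `b` and exploitation samples `W 0, …, W (N - 1)` of the regressor vector. -/
noncomputable def lrmc {κ : Type*} [Fintype κ] (N : ℕ) (W : ℕ → κ → ℝ) (b : κ → ℝ) : ℝ :=
  (1 / (N : ℝ)) * ∑ l ∈ Finset.range N, W l ⬝ᵥ b

end LRMC

/-! Convergence in probability to a constant involves only the law of each term separately. Given
that the whole sequence of coefficient estimates equals `b`, the exploitation samples of budget `k`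
keep their law, because they are independent of the exploration data. Hence the `k`-th coordinate of
the conditional law is the law of `lrmc (N k) · (b k)` under those samples
(`condDistrib_map_eval_ae_eq_map_of_indepFun`), whatever the dependence between budgets.

It remains to treat deterministic coefficients. Almost every `b` converges to `β`: by the strong law
the empirical Gram matrix tends to `Λ` and the empirical cross moments tend to `Λ β`, since the
centered noise is independent of the regressors; the normal equations then give the limit
(`ae_tendsto_betaHat`). For such `b`, the estimator is a sample mean paired with `b k`, so it tends
to the mean regressor paired with `β` (`tendsto_measure_lrmc`). This number is the expectation of
`f(Y)`, by the intercept row of the cross-moment identity. -/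

namespace LRMC

/-! ### Strong law, conditional laws under independence, integrability -/

section General

variable {Ω Ω₀ α β γ : Type*} [MeasurableSpace Ω] [MeasurableSpace Ω₀]
  [MeasurableSpace α] [MeasurableSpace β] [MeasurableSpace γ]

/-- The strong law of large numbers for a function of i.i.d. random elements. -/
theorem ae_tendsto_average_of_iid {P : Measure Ω} {P₀ : Measure Ω₀} {D : ℕ → Ω → α} {Z : Ω₀ → α}
    {g : α → ℝ} (hg : Measurable g) (hD : ∀ l, IdentDistrib (D l) Z P P₀) (hind : iIndepFun D P)
    (hint : Integrable (fun ω => g (Z ω)) P₀) :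
    ∀ᵐ ω ∂P, Tendsto (fun n : ℕ => (∑ l ∈ Finset.range n, g (D l ω)) / n) atTop
      (𝓝 (∫ ω, g (Z ω) ∂P₀)) := by
  have hgD : ∀ l, IdentDistrib (fun ω => g (D l ω)) (fun ω => g (Z ω)) P P₀ :=
    fun l => (hD l).comp hg
  have h := strong_law_ae_real (μ := P) (fun l ω => g (D l ω)) ((hgD 0).integrable_iff.2 hint)
    (fun i j hij => (hind.indepFun hij).comp hg hg) (fun i => (hgD i).trans (hgD 0).symm)
  rwa [(hgD 0).integral_eq] at h

/-- The conditional law of a function of `X` and `V` given `X`, when `V` is independent of `X`. -/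
theorem condDistrib_ae_eq_map_of_indepFun [StandardBorelSpace γ] [Nonempty γ]
    {P : Measure Ω} [IsProbabilityMeasure P] {X : Ω → α} {V : Ω → β} {φ : α × β → γ}
    (hX : AEMeasurable X P) (hV : AEMeasurable V P) (hφ : Measurable φ) (hind : IndepFun X V P) :
    ∀ᵐ x ∂P.map X, condDistrib (fun ω => φ (X ω, V ω)) X P x
      = (P.map V).map (fun v => φ (x, v)) := by
  have : IsProbabilityMeasure (P.map X) := Measure.isProbabilityMeasure_map hX
  have : IsProbabilityMeasure (P.map V) := Measure.isProbabilityMeasure_map hV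
  -- The candidate freezes `X` at `x` and lets `V` keep its law. Disintegrations are almost
  -- everywhere unique, so it is enough to match the joint law of `X` and `φ (X, V)`.
  let κ : Kernel α γ := (Kernel.id ×ₖ Kernel.const α (P.map V)).map φ
  have hκ : ∀ x, κ x = (P.map V).map (fun v => φ (x, v)) := by
    intro x
    rw [Kernel.map_apply _ hφ, Kernel.prod_apply, Kernel.id_apply, Kernel.const_apply,
      Measure.dirac_prod, Measure.map_map hφ measurable_prodMk_left]
    rfl
  have hmk : Measurable fun p : α × β => (p.1, φ p) := measurable_fst.prodMk hφ
  have hlaw : P.map (fun ω => (X ω, φ (X ω, V ω))) = P.map X ⊗ₘ κ := by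
    have h1 : P.map (fun ω => (X ω, φ (X ω, V ω)))
        = ((P.map X).prod (P.map V)).map (fun p => (p.1, φ p)) := by
      rw [← (indepFun_iff_map_prod_eq_prod_map_map hX hV).1 hind,
        AEMeasurable.map_map_of_aemeasurable hmk.aemeasurable (hX.prodMk hV)]
      rfl
    rw [h1]
    ext s hs
    rw [Measure.map_apply hmk hs, Measure.prod_apply (hmk hs), Measure.compProd_apply hs]
    refine lintegral_congr fun x => ?_
    have hφx : Measurable fun v => φ (x, v) := hφ.comp measurable_prodMk_left
    rw [hκ, Measure.map_apply hφx (measurable_prodMk_left hs)]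
    rfl
  filter_upwards [condDistrib_ae_eq_of_measure_eq_compProd X
    (hφ.comp_aemeasurable (hX.prodMk hV)) hlaw] with x hx
  exact hx.trans (hκ x)

/-- The coordinates of the conditional law of `(φ k (X, V k))ₖ` given `X`, when every `V k` is
independent of `X`; the joint law of the `V k` is irrelevant. -/
theorem condDistrib_map_eval_ae_eq_map_of_indepFun {P : Measure Ω} [IsProbabilityMeasure P]
    {X : Ω → α} {V : ℕ → Ω → β} {φ : ℕ → α × β → ℝ} (hX : AEMeasurable X P)
    (hV : ∀ k, AEMeasurable (V k) P) (hφ : ∀ k, Measurable (φ k))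
    (hind : ∀ k, IndepFun X (V k) P) :
    ∀ᵐ x ∂P.map X, ∀ k, (condDistrib (fun ω k => φ k (X ω, V k ω)) X P x).map (fun t => t k)
      = (P.map (V k)).map (fun v => φ k (x, v)) := by
  refine ae_all_iff.2 fun k => ?_
  have hY : AEMeasurable (fun ω k => φ k (X ω, V k ω)) P := aemeasurable_pi_iff.2 fun k =>
    (hφ k).comp_aemeasurable (hX.prodMk (hV k))
  -- Taking a coordinate commutes with conditioning up to a null set, and there are only countably
  -- many `k`.
  filter_upwards [condDistrib_ae_eq_map_of_indepFun hX (hV k) (hφ k) (hind k),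
    condDistrib_comp X hY (measurable_pi_apply k)] with x hx hx'
  rw [Kernel.map_apply _ (measurable_pi_apply k)] at hx'
  exact hx'.symm.trans hx

/-- Two i.i.d. sequences with the same marginal law have the same law. -/
theorem identDistrib_of_iid {P : Measure Ω} {P₀ : Measure Ω₀} {V W : ℕ → Ω → α} {Z : Ω₀ → α}
    (hV : ∀ l, IdentDistrib (V l) Z P P₀) (hW : ∀ l, IdentDistrib (W l) Z P P₀)
    (hVi : iIndepFun V P) (hWi : iIndepFun W P) :
    P.map (fun ω l => V l ω) = P.map (fun ω l => W l ω) := by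
  rw [hVi.map_fun_eq_infinitePi_map₀' fun l => (hV l).aemeasurable_fst,
    hWi.map_fun_eq_infinitePi_map₀' fun l => (hW l).aemeasurable_fst]
  congr 1
  funext l
  rw [(hV l).map_eq, (hW l).map_eq]

/-- Integrability from a finite integral of `exp (|W| ^ 2 / C ^ 2)`. -/
theorem integrable_of_orliczNorm_two_lt_top {P : Measure Ω} [IsFiniteMeasure P] {W : Ω → ℝ}
    (hW : AEStronglyMeasurable W P) (h : orliczNorm 2 W P < ∞) : Integrable W P := by
  obtain ⟨C, hC0, hC⟩ : ∃ C : ℝ, 0 < C ∧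
      ∫⁻ ω, ENNReal.ofReal (Real.exp (|W ω| ^ (2 : ℝ) / C ^ (2 : ℝ))) ∂P ≤ 2 := by
    by_contra hne
    exact h.ne (iInf₂_eq_top.2 fun C hC => (hne ⟨C, hC⟩).elim)
  have hexp : Integrable (fun ω => Real.exp (|W ω| ^ (2 : ℝ) / C ^ (2 : ℝ))) P := by
    refine ⟨Real.measurable_exp.comp_aemeasurable ?_ |>.aestronglyMeasurable, ?_⟩
    · exact (hW.aemeasurable.abs.pow_const _).div_const _
    · rw [hasFiniteIntegral_iff_ofReal (ae_of_all _ fun _ => (Real.exp_pos _).le)]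
      exact hC.trans_lt (by simp)
  -- Domination: with `u = |W| / C`, `u ≤ u ^ 2 + 1 ≤ exp (u ^ 2)`.
  refine (hexp.const_mul C).mono' hW (ae_of_all _ fun ω => ?_)
  have h1 := Real.add_one_le_exp (|W ω| ^ (2 : ℝ) / C ^ (2 : ℝ))
  rw [Real.rpow_two, Real.rpow_two, ← div_pow] at h1 ⊢
  have h2 : |W ω| = C * (|W ω| / C) := by field_simp
  rw [Real.norm_eq_abs]
  calc |W ω| = C * (|W ω| / C) := h2
    _ ≤ C * Real.exp ((|W ω| / C) ^ 2) := by
      gcongr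
      nlinarith [sq_nonneg (|W ω| / C - 1), sq_nonneg (|W ω| / C)]

/-- The coordinates of a random vector with finite fourth directional moments lie in `L⁴`. -/
theorem memLp_four_of_fourthMomentSup_lt_top {κ : Type*} [Fintype κ] {P : Measure Ω}
    {V : Ω → κ → ℝ} (hV : AEMeasurable V P) (h : fourthMomentSup V P < ∞) (i : κ) :
    MemLp (fun ω => V ω i) 4 P := by
  classical
  have hVi : AEMeasurable (fun ω => V ω i) P := (measurable_pi_apply i).comp_aemeasurable hV
  have h1 : (∫⁻ ω, ENNReal.ofReal (V ω i ^ 4) ∂P) ^ (1 / 4 : ℝ) < ∞ := by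
    refine lt_of_le_of_lt ?_ h
    -- Testing against a standard unit vector isolates one coordinate.
    have := le_iSup₂ (f := fun (θ : EuclideanSpace ℝ κ) (_ : ‖θ‖ = 1) =>
      (∫⁻ ω, ENNReal.ofReal ((inner ℝ (WithLp.toLp 2 (V ω)) θ) ^ 4) ∂P) ^ (1 / 4 : ℝ))
      (EuclideanSpace.single i 1) (by simp)
    simpa [fourthMomentSup, EuclideanSpace.inner_single_right] using this
  have h2 : ∫⁻ ω, ENNReal.ofReal (V ω i ^ 4) ∂P < ∞ := by
    by_contra hne
    rw [not_lt_top_iff.1 hne] at h1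
    norm_num at h1
  refine (integrable_norm_rpow_iff hVi.aestronglyMeasurable (by norm_num) (by norm_num)).1 ?_
  have heq : (fun ω => ‖V ω i‖ ^ (4 : ℝ≥0∞).toReal) = fun ω => V ω i ^ 4 := by
    funext ω
    have : ((4 : ℝ≥0∞).toReal) = ((4 : ℕ) : ℝ) := by norm_num
    rw [this, Real.rpow_natCast, Real.norm_eq_abs, Even.pow_abs (by decide)]
  rw [heq]
  refine ⟨(hVi.pow_const 4).aestronglyMeasurable, ?_⟩
  rw [hasFiniteIntegral_iff_ofReal (ae_of_all _ fun _ => by positivity)]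
  exact h2

end General

/-! ### Consistency of least squares -/

section Regression

variable {n : ℕ} {S : Finset (Fin n)}

theorem measurable_regressor (S : Finset (Fin n)) : Measurable (regressor S) := by
  refine measurable_pi_lambda _ fun j => ?_
  cases j with
  | none => exact measurable_const
  | some i => exact measurable_pi_apply _

/-- The normalized Gram matrix of the first `m` exploration samples. -/
noncomputable def empiricalGram (S : Finset (Fin n)) (m : ℕ) (D : ℕ → (Fin n → ℝ) × ℝ) :
    Matrix (Option S) (Option S) ℝ :=
  Matrix.of fun i j =>
    (∑ l ∈ Finset.range m, regressor S (D l).1 i * regressor S (D l).1 j) / m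

/-- The normalized cross moments of regressors and responses in the first `m` exploration
samples. -/
noncomputable def empiricalCross (S : Finset (Fin n)) (m : ℕ) (D : ℕ → (Fin n → ℝ) × ℝ) :
    Option S → ℝ :=
  fun i => (∑ l ∈ Finset.range m, regressor S (D l).1 i * (D l).2) / m

theorem empiricalGram_eq (m : ℕ) (D : ℕ → (Fin n → ℝ) × ℝ) :
    empiricalGram S m D = (m : ℝ)⁻¹ • ((designMatrix S m D)ᵀ * designMatrix S m D) := by
  ext i j
  simp only [empiricalGram, designMatrix, Matrix.of_apply, Matrix.smul_apply, Matrix.mul_apply,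
    Matrix.transpose_apply, smul_eq_mul]
  rw [Finset.sum_range, div_eq_inv_mul]

theorem empiricalCross_eq (m : ℕ) (D : ℕ → (Fin n → ℝ) × ℝ) :
    empiricalCross S m D = (m : ℝ)⁻¹ • ((designMatrix S m D)ᵀ *ᵥ responseVector m D) := by
  ext i
  simp only [empiricalCross, designMatrix, responseVector, Matrix.mulVec, dotProduct,
    Matrix.of_apply, Matrix.transpose_apply, Pi.smul_apply, smul_eq_mul]
  rw [Finset.sum_range, div_eq_inv_mul]

/-- The normal equations, for an invertible Gram matrix. -/
theorem betaHat_eq_of_isUnit {m : ℕ} {D : ℕ → (Fin n → ℝ) × ℝ} (hm : m ≠ 0)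
    (h : IsUnit (empiricalGram S m D)) :
    betaHat S m D = (empiricalGram S m D)⁻¹ *ᵥ empiricalCross S m D := by
  have hm' : (m : ℝ) ≠ 0 := Nat.cast_ne_zero.2 hm
  have hZ : (designMatrix S m D)ᵀ * designMatrix S m D = (m : ℝ) • empiricalGram S m D := by
    rw [empiricalGram_eq, smul_inv_smul₀ hm']
  have hu : IsUnit ((designMatrix S m D)ᵀ * designMatrix S m D) := by
    rw [hZ]
    exact h.smul (Units.mk0 (m : ℝ) hm')
  have hnormal : empiricalGram S m D *ᵥ betaHat S m D = empiricalCross S m D := by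
    rw [empiricalGram_eq, empiricalCross_eq, betaHat, pinv_eq_of_isUnit _ hu, Matrix.smul_mulVec,
      Matrix.mulVec_mulVec, ← Matrix.mul_assoc,
      Matrix.mul_nonsing_inv _ ((Matrix.isUnit_iff_isUnit_det _).1 hu), Matrix.one_mul]
  rw [← hnormal, Matrix.mulVec_mulVec,
    Matrix.nonsing_inv_mul _ ((Matrix.isUnit_iff_isUnit_det _).1 h), Matrix.one_mulVec]

/-- Least squares is consistent along any sequence of samples whose empirical moments converge. -/
theorem tendsto_betaHat {D : ℕ → (Fin n → ℝ) × ℝ} {Λ : Matrix (Option S) (Option S) ℝ}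
    {β : Option S → ℝ} (hΛ : IsUnit Λ)
    (hgram : Tendsto (fun m => empiricalGram S m D) atTop (𝓝 Λ))
    (hcross : Tendsto (fun m => empiricalCross S m D) atTop (𝓝 (Λ *ᵥ β))) :
    Tendsto (fun m => betaHat S m D) atTop (𝓝 β) := by
  have hdet : Λ.det ≠ 0 := ((Matrix.isUnit_iff_isUnit_det _).1 hΛ).ne_zero
  have hdet_tendsto : Tendsto (fun m => (empiricalGram S m D).det) atTop (𝓝 Λ.det) :=
    (continuous_id.matrix_det.tendsto Λ).comp hgram
  -- The limit determinant is nonzero, so the pseudoinverse is eventually given by the normal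
  -- equations; earlier values of `m` do not affect the limit.
  have hev : ∀ᶠ m in atTop, IsUnit (empiricalGram S m D) := by
    filter_upwards [hdet_tendsto.eventually_ne hdet] with m hm
    exact (Matrix.isUnit_iff_isUnit_det _).2 (isUnit_iff_ne_zero.2 hm)
  have hinv : Tendsto (fun m => (empiricalGram S m D)⁻¹) atTop (𝓝 Λ⁻¹) := by
    refine (continuousAt_matrix_inv Λ ?_).tendsto.comp hgram
    rw [Ring.inverse_eq_inv']
    exact continuousAt_inv₀ hdet
  have hmv : Continuous fun p : Matrix (Option S) (Option S) ℝ × (Option S → ℝ) => p.1 *ᵥ p.2 :=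
    continuous_fst.matrix_mulVec continuous_snd
  have hlim := (hmv.tendsto (Λ⁻¹, Λ *ᵥ β)).comp (hinv.prodMk_nhds hcross)
  rw [Matrix.mulVec_mulVec, Matrix.nonsing_inv_mul _ ((Matrix.isUnit_iff_isUnit_det _).1 hΛ),
    Matrix.one_mulVec] at hlim
  refine hlim.congr' ?_
  filter_upwards [hev, eventually_ne_atTop 0] with m hm hm0
  exact (betaHat_eq_of_isUnit hm0 hm).symm

/-- Almost sure consistency of least squares for i.i.d. samples. -/
theorem ae_tendsto_betaHat {Ω Ω₀ : Type*} [MeasurableSpace Ω] [MeasurableSpace Ω₀]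
    {P : Measure Ω} {P₀ : Measure Ω₀} {x : Ω₀ → Fin n → ℝ} {y : Ω₀ → ℝ}
    {D : ℕ → Ω → (Fin n → ℝ) × ℝ} {β : Option S → ℝ}
    (hD : ∀ l, IdentDistrib (D l) (fun ω => (x ω, y ω)) P P₀) (hind : iIndepFun D P)
    (hxx : ∀ i j, Integrable (fun ω => regressor S (x ω) i * regressor S (x ω) j) P₀)
    (hxy : ∀ i, Integrable (fun ω => regressor S (x ω) i * y ω) P₀)
    (hunit : IsUnit (secondMoment (fun ω => regressor S (x ω)) P₀))
    (hβ : ∀ i, ∫ ω, regressor S (x ω) i * y ω ∂P₀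
      = (secondMoment (fun ω => regressor S (x ω)) P₀ *ᵥ β) i) :
    ∀ᵐ ω ∂P, Tendsto (fun m => betaHat S m (fun l => D l ω)) atTop (𝓝 β) := by
  have hreg : ∀ i, Measurable fun d : (Fin n → ℝ) × ℝ => regressor S d.1 i := fun i =>
    (measurable_pi_apply i).comp ((measurable_regressor S).comp measurable_fst)
  have hgram := ae_all_iff.2 fun i => ae_all_iff.2 fun j =>
    ae_tendsto_average_of_iid ((hreg i).mul (hreg j)) hD hind (hxx i j)
  have hcross := ae_all_iff.2 fun i =>
    ae_tendsto_average_of_iid ((hreg i).mul measurable_snd) hD hind (hxy i)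
  filter_upwards [hgram, hcross] with ω hg hc
  refine tendsto_betaHat hunit ?_ ?_
  · exact tendsto_pi_nhds.2 fun i => tendsto_pi_nhds.2 fun j => hg i j
  · refine tendsto_pi_nhds.2 fun i => ?_
    rw [← hβ i]
    exact hc i

end Regression

/-! ### Exploitation with deterministic coefficients -/

section Exploitation

variable {κ : Type*} [Fintype κ]

theorem measurable_lrmc (N : ℕ) :
    Measurable fun p : (κ → ℝ) × (ℕ → κ → ℝ) => lrmc N p.2 p.1 := by
  simp only [lrmc, dotProduct]
  refine (Finset.measurable_sum _ fun l _ => Finset.measurable_sum _ fun i _ => ?_).const_mul _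
  have h1 : Measurable fun p : (κ → ℝ) × (ℕ → κ → ℝ) => p.2 l :=
    (measurable_pi_apply l).comp measurable_snd
  exact ((measurable_pi_apply i).comp h1).mul ((measurable_pi_apply i).comp measurable_fst)

/-- The estimator is the inner product of the sample mean with the coefficient vector. -/
theorem lrmc_eq (N : ℕ) (W : ℕ → κ → ℝ) (b : κ → ℝ) :
    lrmc N W b = (fun i => (∑ l ∈ Finset.range N, W l i) / N) ⬝ᵥ b := by
  simp only [lrmc, dotProduct]
  rw [Finset.sum_comm, Finset.mul_sum]
  refine Finset.sum_congr rfl fun i _ => ?_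
  rw [← Finset.sum_mul]
  ring

/-- If the coefficient vectors converge, then the estimators converge in probability; the joint law
of the exploitation samples over different budgets is irrelevant. -/
theorem tendsto_measure_lrmc {Ω Ω₀ : Type*} [MeasurableSpace Ω] [MeasurableSpace Ω₀]
    {P : Measure Ω} [IsProbabilityMeasure P] {P₀ : Measure Ω₀} {V : Ω₀ → κ → ℝ}
    {W : ℕ → ℕ → Ω → κ → ℝ} (hW : ∀ k l, IdentDistrib (W k l) V P P₀)
    (hind : ∀ k, iIndepFun (W k) P) (hint : ∀ i, Integrable (fun ω => V ω i) P₀)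
    {N : ℕ → ℕ} (hN : Tendsto N atTop atTop) {b : ℕ → κ → ℝ} {β : κ → ℝ}
    (hb : Tendsto b atTop (𝓝 β)) {δ : ℝ≥0∞} (hδ : 0 < δ) :
    Tendsto (fun k => ((P.map fun ω l => W k l ω).map fun w => lrmc (N k) w (b k))
      {t | δ ≤ edist t ((fun i => ∫ ω, V ω i ∂P₀) ⬝ᵥ β)}) atTop (𝓝 0) := by
  have hae : ∀ k, AEMeasurable (fun ω l => W k l ω) P := fun k =>
    aemeasurable_pi_iff.2 fun l => (hW k l).aemeasurable_fst
  have hmeas : ∀ k, Measurable fun w : ℕ → κ → ℝ => lrmc (N k) w (b k) := fun k => by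
    have hpair : Measurable fun w : ℕ → κ → ℝ => (b k, w) := measurable_prodMk_left
    simpa only [Function.comp_def] using (measurable_lrmc (N k)).comp hpair
  generalize hv : (fun i => ∫ ω, V ω i ∂P₀) = v
  have hlln := ae_all_iff.2 fun i =>
    ae_tendsto_average_of_iid (measurable_pi_apply i) (hW 0) (hind 0) (hint i)
  -- The samples of budget `0` serve every budget here: on this single sequence the strong law holds
  -- almost surely, hence also along `N k`.
  have hlim : TendstoInMeasure P (fun k ω => lrmc (N k) (fun l => W 0 l ω) (b k)) atTop
      (fun _ => v ⬝ᵥ β) := by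
    refine tendstoInMeasure_of_tendsto_ae
      (fun k => ((hmeas k).comp_aemeasurable (hae 0)).aestronglyMeasurable) ?_
    filter_upwards [hlln] with ω hω
    simp only [lrmc_eq, dotProduct]
    refine tendsto_finsetSum _ fun i _ => ?_
    rw [← hv]
    exact ((hω i).comp hN).mul (tendsto_pi_nhds.1 hb i)
  have hset : MeasurableSet {t : ℝ | δ ≤ edist t (v ⬝ᵥ β)} :=
    measurableSet_le measurable_const (measurable_id.edist measurable_const)
  refine (hlim δ hδ).congr fun k => ?_
  -- Only the law of each term matters, so the samples of budget `k` may be exchanged for those of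
  -- budget `0`.
  rw [identDistrib_of_iid (hW k) (hW 0) (hind k) (hind 0),
    AEMeasurable.map_map_of_aemeasurable (hmeas k).aemeasurable (hae 0),
    Measure.map_apply_of_aemeasurable ((hmeas k).comp_aemeasurable (hae 0)) hset]
  rfl

end Exploitation

/-- Cross moments of regressors and responses in a linear model with independent centered noise. -/
theorem integrable_and_integral_regressor_mul {Ω₀ κ : Type*} [MeasurableSpace Ω₀] [Fintype κ]
    {P₀ : Measure Ω₀} {V : Ω₀ → κ → ℝ} {y ε : Ω₀ → ℝ} {β : κ → ℝ}
    (hlin : ∀ᵐ ω ∂P₀, y ω = V ω ⬝ᵥ β + ε ω) (hind : IndepFun ε V P₀)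
    (hε : Integrable ε P₀) (hε_mean : ∫ ω, ε ω ∂P₀ = 0)
    (hV : ∀ i, Integrable (fun ω => V ω i) P₀)
    (hVV : ∀ i j, Integrable (fun ω => V ω i * V ω j) P₀) (i : κ) :
    Integrable (fun ω => V ω i * y ω) P₀ ∧
      ∫ ω, V ω i * y ω ∂P₀ = (secondMoment V P₀ *ᵥ β) i := by
  have hindi : IndepFun (fun ω => V ω i) ε P₀ :=
    (hind.comp measurable_id (measurable_pi_apply i)).symm
  -- A product of independent integrable variables is integrable, and its mean factors.
  have hnoise : Integrable (fun ω => V ω i * ε ω) P₀ := hindi.integrable_mul (hV i) hε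
  have hnoise0 : ∫ ω, V ω i * ε ω ∂P₀ = 0 := by
    rw [hindi.integral_fun_mul_eq_mul_integral (hV i).1 hε.1, hε_mean, mul_zero]
  have hterm : ∀ j, Integrable (fun ω => V ω i * V ω j * β j) P₀ := fun j =>
    (hVV i j).mul_const _
  have hsum : Integrable (fun ω => ∑ j, V ω i * V ω j * β j) P₀ :=
    integrable_finsetSum _ fun j _ => hterm j
  have heq : (fun ω => V ω i * y ω) =ᵐ[P₀]
      fun ω => (∑ j, V ω i * V ω j * β j) + V ω i * ε ω := by
    filter_upwards [hlin] with ω hω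
    rw [hω, mul_add, dotProduct, Finset.mul_sum]
    simp only [mul_assoc]
  refine ⟨(hsum.add hnoise).congr heq.symm, ?_⟩
  rw [integral_congr_ae heq, integral_add hsum hnoise, hnoise0, add_zero,
    integral_finsetSum _ fun j _ => hterm j]
  simp only [integral_mul_const]
  rfl

end LRMC

/-! ### Consistency of the estimator -/

theorem mainTheorem4
    -- population: high-fidelity model `Y` with output map `f`, low-fidelity outputs `X i`
    {Ω₀ 𝓨 : Type*} [MeasurableSpace Ω₀] [MeasurableSpace 𝓨]
    (P₀ : Measure Ω₀) [IsProbabilityMeasure P₀]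
    {n : ℕ} (X : Fin n → Ω₀ → ℝ) (hX : ∀ i, Measurable (X i))
    (Y : Ω₀ → 𝓨) (hY : Measurable Y) (f : 𝓨 → ℝ) (hf : Measurable f)
    -- linear model assumption for a nonempty `S`
    (S : Finset (Fin n)) (hS : S.Nonempty)
    (XS : Ω₀ → Option S → ℝ) (hXS : XS = fun ω => LRMC.regressor S (fun i => X i ω))
    (β : Option S → ℝ) (ε : Ω₀ → ℝ) (hε : Measurable ε)
    (hlin : ∀ᵐ ω ∂P₀, f (Y ω) = XS ω ⬝ᵥ β + ε ω)
    (hε_indep : IndepFun ε XS P₀)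
    (hε_mean : ∫ ω, ε ω ∂P₀ = 0)
    (hε_subG : LRMC.orliczNorm 2 ε P₀ < ∞)
    -- moment assumptions on the regressor vector
    (K : ℝ) (hK : 1 ≤ K)
    (hmom : max (LRMC.fourthMomentSup XS P₀)
      (LRMC.orliczNorm 1 (fun ω => ‖WithLp.toLp 2 (XS ω)‖) P₀) ≤ ENNReal.ofReal K)
    (hΛ : IsUnit (LRMC.secondMoment XS P₀))
    -- costs, budgets, numbers of exploration rounds
    (c₀ : ℝ) (hc₀ : 0 < c₀) (c : Fin n → ℝ) (hc : ∀ i, 0 < c i)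
    (B : ℕ → ℝ) (hB : Tendsto B atTop atTop)
    (m N : ℕ → ℕ) (hN : ∀ k, N k = LRMC.numExploit c₀ c S (B k) (m k))
    (hmN : Tendsto (fun k => min (m k) (N k)) atTop atTop)
    -- exploration samples: i.i.d. copies of `((X i)_i, f Y)`
    {Ω : Type*} [MeasurableSpace Ω] (P : Measure Ω) [IsProbabilityMeasure P]
    (D : ℕ → Ω → (Fin n → ℝ) × ℝ)
    (hD_law : ∀ l, IdentDistrib (D l) (fun ω => (fun i => X i ω, f (Y ω))) P P₀)
    (hD_indep : iIndepFun D P)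
    -- exploitation samples for the `k`-th budget: i.i.d. copies of `XS`, independent of exploration
    (W : ℕ → ℕ → Ω → Option S → ℝ)
    (hW_law : ∀ k l, IdentDistrib (W k l) XS P P₀)
    (hW_indep : ∀ k, iIndepFun (W k) P)
    (hDW : ∀ k, IndepFun (fun ω l => D l ω) (fun ω l => W k l ω) P)
    -- the coefficient estimates and the estimators, as sequences in `k`
    (βhat : Ω → ℕ → Option S → ℝ)
    (hβhat : βhat = fun ω k => LRMC.betaHat S (m k) (fun l => D l ω))
    (L : Ω → ℕ → ℝ)
    (hL : L = fun ω k => LRMC.lrmc (N k) (fun l => W k l ω) (βhat ω k)) :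
    -- for almost every sequence `b` of coefficient estimates, under the conditional law given
    -- that the sequence of coefficient estimates is `b`, the estimators converge in probability
    ∀ᵐ b ∂(P.map βhat),
      TendstoInMeasure (condDistrib L βhat P b) (fun (k : ℕ) (x : ℕ → ℝ) => x k) atTop
        (fun _ => ∫ ω, f (Y ω) ∂P₀) := by
  subst hXS hβhat hL
  have hx : Measurable fun ω i => X i ω := measurable_pi_lambda _ hX
  have hV : Measurable fun ω => LRMC.regressor S fun i => X i ω :=
    (LRMC.measurable_regressor S).comp hx
  have hL4 := LRMC.memLp_four_of_fourthMomentSup_lt_top hV.aemeasurable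
    (((le_max_left _ _).trans hmom).trans_lt ENNReal.ofReal_lt_top)
  have hL2 := fun i => (hL4 i).mono_exponent (p := 2) (by norm_num)
  have hint := fun i => (hL4 i).integrable (by norm_num)
  have hint2 := fun i j => (hL2 i).integrable_mul (hL2 j)
  have hεint := LRMC.integrable_of_orliczNorm_two_lt_top hε.aestronglyMeasurable hε_subG
  have hcross := LRMC.integrable_and_integral_regressor_mul hlin hε_indep hεint hε_mean hint hint2
  have hmean : ∫ ω, f (Y ω) ∂P₀
      = (fun i => ∫ ω, LRMC.regressor S (fun i => X i ω) i ∂P₀) ⬝ᵥ β := by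
    -- The regressor at `none` is `1`, so this row of the identity reads off the mean response.
    have h := (hcross none).2
    simpa [LRMC.regressor, LRMC.secondMoment, Matrix.mulVec] using h
  have hβ_ae := LRMC.ae_tendsto_betaHat hD_law hD_indep hint2 (fun i => (hcross i).1) hΛ
    fun i => (hcross i).2
  have hm : Tendsto m atTop atTop := tendsto_atTop_mono (fun k => min_le_left _ _) hmN
  have hN' : Tendsto N atTop atTop := tendsto_atTop_mono (fun k => min_le_right _ _) hmN
  have hDae : AEMeasurable (fun ω l => D l ω) P :=
    aemeasurable_pi_iff.2 fun l => (hD_law l).aemeasurable_fst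
  have hWae : ∀ k, AEMeasurable (fun ω l => W k l ω) P := fun k =>
    aemeasurable_pi_iff.2 fun l => (hW_law k l).aemeasurable_fst
  have hest : Measurable fun (d : ℕ → (Fin n → ℝ) × ℝ) k => LRMC.betaHat S (m k) d :=
    measurable_pi_lambda _ fun k => LRMC.measurable_betaHat S (m k)
  set βhat : Ω → ℕ → Option S → ℝ := fun ω k => LRMC.betaHat S (m k) (fun l => D l ω)
  have hβae : AEMeasurable βhat P := hest.comp_aemeasurable hDae
  set L : Ω → ℕ → ℝ := fun ω k => LRMC.lrmc (N k) (fun l => W k l ω) (βhat ω k)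
  have hφ : ∀ k, Measurable fun p : (ℕ → Option S → ℝ) × (ℕ → Option S → ℝ) =>
      LRMC.lrmc (N k) p.2 (p.1 k) := fun k => by
    have hpair : Measurable fun p : (ℕ → Option S → ℝ) × (ℕ → Option S → ℝ) => (p.1 k, p.2) :=
      ((measurable_pi_apply k).comp measurable_fst).prodMk measurable_snd
    simpa only [Function.comp_def] using (LRMC.measurable_lrmc (N k)).comp hpair
  have hlim : ∀ᵐ b ∂P.map βhat, Tendsto b atTop (𝓝 β) := by
    -- Convergence to `β` is a measurable property of the sequence, so it passes from samples to the
    -- law of the estimates.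
    refine (ae_map_iff hβae (measurableSet_tendsto _ fun k => measurable_pi_apply k)).2 ?_
    filter_upwards [hβ_ae] with ω hω
    exact hω.comp hm
  have hcond : ∀ᵐ b ∂P.map βhat, ∀ k, (condDistrib L βhat P b).map (fun x => x k)
      = (P.map fun ω l => W k l ω).map fun w => LRMC.lrmc (N k) w (b k) :=
    LRMC.condDistrib_map_eval_ae_eq_map_of_indepFun hβae hWae hφ
      fun k => (hDW k).comp hest measurable_id
  filter_upwards [hlim, hcond] with b hb hbk δ hδ
  rw [hmean]
  -- The deviation event at `k` depends on coordinate `k` alone, so its conditional probability is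
  -- computed from that marginal.
  refine (LRMC.tendsto_measure_lrmc hW_law hW_indep hint hN' hb hδ).congr fun k => ?_
  have hset : MeasurableSet {t : ℝ | δ ≤ edist t
      ((fun i => ∫ ω, LRMC.regressor S (fun i => X i ω) i ∂P₀) ⬝ᵥ β)} :=
    measurableSet_le measurable_const (measurable_id.edist measurable_const)
  rw [← hbk k, Measure.map_apply (measurable_pi_apply k) hset]
  rfl
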